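/- Let $R$ be an associative ring with identity and let $\mathcal{X}$ be a class of finitely presented $R$-modules that is closed under extensions. A module $E$ is called $\mathcal{X}$-injective if for every short exact sequence of modules $0\to A\to B\to B/A\to 0$ with $B/A\in\mathcal{X}$, every homomorphism $A\to E$ extends to $B$. A preenvelope of an object $M$ with respect to a class $\mathcal{P}$ of objects is a morphism $\varphi:M\to E$ with $E\in\mathcal{P}$ such that every morphism from $M$ to an object of $\mathcal{P}$ factors through $\varphi$. Suppose that every module in $\mathcal{X}$ has a monic preenvelope with respect to the class of $\mathcal{X}$-injective modules whose cokernel is in $\mathcal{X}$. (This holds in particular if every $R$-module has such a preenvelope. It is not assumed that $\mathcal{X}$ is closed under direct limits.) Let $C(\mathcal{X}^*)$ be the class of complexes $\cdots\to C_{n+1}\to C_n\to C_{n-1}\to\cdots$ (indexed by $n\in\mathbb{Z}$) with all $C_n\in\mathcal{X}$. Call such a complex right bounded if there is an $n$ with $C_i=0$ for all $i<n$, and call a complex finitely generated if it is bounded on both sides and all its terms are finitely generated. A complex $E$ is called $\mathcal{X}$-f.g.injective if for every short exact sequence of complexes $0\to A\to B\to B/A\to 0$ with $B/A$ a finitely generated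 complex in $C(\mathcal{X}^*)$, every chain map $A\to E$ extends to $B$; the class of these complexes is denoted $C(\mathcal{X}\text{-f.g.injective})$. Then: 1. for every right bounded complex $Y$ in $C(\mathcal{X}^*)$ there are an exact complex $E$ and a monomorphism $Y\to E$ which is a preenvelope of $Y$ with respect to $C(\mathcal{X}\text{-f.g.injective})$; 2. every right bounded $\mathcal{X}$-f.g.injective complex in $C(\mathcal{X}^*)$ is exact. -/

import Mathlib

open CategoryTheory

universe v u w

namespace XInj

/-- `φ : M ⟶ E` is a preenvelope of `M` with respect to the class `P` of objects:
`E` belongs to `P` and every morphism from `M` to an object of `P` factors through `φ`. -/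
structure IsPreenvelope {C : Type w} [Category.{v} C] (P : ObjectProperty C) {M E : C}
    (φ : M ⟶ E) : Prop where
  mem : P E
  factors : ∀ ⦃E' : C⦄, P E' → ∀ f : M ⟶ E', ∃ g : E ⟶ E', φ ≫ g = f

variable {R : Type u} [Ring R]

/-- A module `E` is `X`-injective if it is injective with respect to every short exact sequence
`0 ⟶ A ⟶ B ⟶ B/A ⟶ 0` with `B/A` in `X`. -/
def XInjective (X : ObjectProperty (ModuleCat.{v} R)) : ObjectProperty (ModuleCat.{v} R) :=
  fun E => ∀ S : ShortComplex (ModuleCat.{v} R), S.ShortExact → X S.X₃ →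
    ∀ g : S.X₁ ⟶ E, ∃ h : S.X₂ ⟶ E, S.f ≫ h = g

/-- The class `C(X*)` of complexes `⋯ ⟶ Cₙ₊₁ ⟶ Cₙ ⟶ Cₙ₋₁ ⟶ ⋯` all of whose terms are in `X`. -/
def XStar (X : ObjectProperty (ModuleCat.{v} R)) :
    ObjectProperty (ChainComplex (ModuleCat.{v} R) ℤ) :=
  fun C => ∀ i : ℤ, X (C.X i)

/-- A right bounded complex `⋯ ⟶ Cₙ₊₁ ⟶ Cₙ ⟶ 0 ⟶ 0 ⟶ ⋯`. -/
def RightBounded (C : ChainComplex (ModuleCat.{v} R) ℤ) : Prop :=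
  ∃ n : ℤ, ∀ i : ℤ, i < n → Limits.IsZero (C.X i)

/-- A left bounded complex `⋯ ⟶ 0 ⟶ 0 ⟶ Cₙ ⟶ Cₙ₋₁ ⟶ ⋯`. -/
def LeftBounded (C : ChainComplex (ModuleCat.{v} R) ℤ) : Prop :=
  ∃ n : ℤ, ∀ i : ℤ, n < i → Limits.IsZero (C.X i)

/-- A finitely generated complex: a bounded complex of finitely generated modules. -/
def FGComplex (C : ChainComplex (ModuleCat.{v} R) ℤ) : Prop :=
  LeftBounded C ∧ RightBounded C ∧ ∀ i : ℤ, Module.Finite R (C.X i)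

/-- A complex `E` is `X`-f.g.injective if it is injective with respect to every short exact
sequence `0 ⟶ A ⟶ B ⟶ B/A ⟶ 0` of complexes with `B/A` a finitely generated complex
in `C(X*)`. -/
def XFGInjective (X : ObjectProperty (ModuleCat.{v} R)) :
    ObjectProperty (ChainComplex (ModuleCat.{v} R) ℤ) :=
  fun E => ∀ S : ShortComplex (ChainComplex (ModuleCat.{v} R) ℤ), S.ShortExact →
    FGComplex S.X₃ → XStar X S.X₃ → ∀ g : S.X₁ ⟶ E, ∃ h : S.X₂ ⟶ E, S.f ≫ h = g

end XInj

namespace XInj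

open Limits

variable {R : Type u} [Ring R]

/-! ### Extension-closed classes in an abelian category. -/

section Closure

variable {C : Type w} [Category.{v} C] [Abelian C] (X : ObjectProperty C)
  [X.IsClosedUnderExtensions]

/-! Choose monic preenvelopes `ι k : Y.X k ⟶ I k` and embed `Y` into the contractible complex
`diskSum I`, which is exact, and is `X`-f.g. injective because chain maps into it are arbitrary
families of maps to the `I k` (`xfgInjective_diskSum`). In each degree the cokernel of the embedding
is an extension of `cokernel (ι k)` by `I (k - 1)`, hence in `X` (`prop_cokernel_lift`).

For the factorization, a map from `Y` to an `X`-f.g. injective complex is extended one degree at a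
time, starting where everything vanishes. Each step is a lifting problem whose cokernel sits in a
single degree, hence is a finitely generated complex (`XFGInjective.exists_extension`). If `Y` is
itself `X`-f.g. injective, its identity factors through the embedding, so `Y` is a retract of an
exact complex. -/

instance isClosedUnderIsomorphisms_of_extensions [X.ContainsZero] : X.IsClosedUnderIsomorphisms where
  of_iso {M N} e hM := by
    obtain ⟨Z, hZ, hXZ⟩ := X.exists_prop_of_containsZero
    -- `N` is an extension of a zero object by `M`.
    refine X.prop_X₂_of_shortExact (S := ShortComplex.mk e.hom (0 : N ⟶ Z) comp_zero)
      { exact := ?_, mono_f := inferInstance, epi_g := ?_ } hM hXZ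
    · exact (ShortComplex.exact_iff_epi _ rfl).2 (inferInstanceAs (Epi e.hom))
    · exact ⟨fun _ _ _ => hZ.eq_of_src _ _⟩

/-- The cokernel of `(ι, t) : M ⟶ I ⊞ J`, with `ι` monic, is an extension of `coker ι` by `J`. -/
lemma shortExact_cokernel_lift {M I J : C} (ι : M ⟶ I) [Mono ι] (t : M ⟶ J) :
    (ShortComplex.mk (biprod.inr ≫ cokernel.π (biprod.lift ι t))
      (cokernel.desc (biprod.lift ι t) (biprod.fst ≫ cokernel.π ι) (by simp))
      (by simp)).ShortExact := by
  have hex : (ShortComplex.mk (biprod.lift ι t) (cokernel.π (biprod.lift ι t))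
      (cokernel.condition _)).Exact := ShortComplex.exact_cokernel _
  have hexι : (ShortComplex.mk ι (cokernel.π ι) (cokernel.condition _)).Exact :=
    ShortComplex.exact_cokernel _
  refine { exact := ?_, mono_f := ?_, epi_g := ?_ }
  · rw [ShortComplex.exact_iff_exact_up_to_refinements]
    intro A x hx
    dsimp at x hx
    obtain ⟨A₁, π₁, _, y, hy⟩ :=
      surjective_up_to_refinements_of_epi (cokernel.π (biprod.lift ι t)) x
    have h1 : (y ≫ biprod.fst) ≫ cokernel.π ι = 0 := by
      have := congrArg (π₁ ≫ ·) hx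
      rw [← Category.assoc, hy] at this
      simpa using this
    obtain ⟨A₂, π₂, _, m, hm⟩ := hexι.exact_up_to_refinements (y ≫ biprod.fst) h1
    dsimp at m hm
    refine ⟨A₂, π₂ ≫ π₁, inferInstance, π₂ ≫ y ≫ biprod.snd - m ≫ t, ?_⟩
    have h2 : π₂ ≫ y = m ≫ biprod.lift ι t + (π₂ ≫ y ≫ biprod.snd - m ≫ t) ≫ biprod.inr := by
      ext
      · simpa using hm
      · simp
    have h3 : (π₂ ≫ y) ≫ cokernel.π (biprod.lift ι t) =
        (π₂ ≫ y ≫ biprod.snd - m ≫ t) ≫ biprod.inr ≫ cokernel.π (biprod.lift ι t) := by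
      rw [h2, Preadditive.add_comp, Category.assoc, cokernel.condition, comp_zero, zero_add,
        Category.assoc]
    rw [Category.assoc π₂ π₁ x, hy]
    exact (Category.assoc _ _ _).symm.trans h3
  · refine Preadditive.mono_of_cancel_zero _ fun {A} x hx => ?_
    dsimp at x hx
    obtain ⟨A₁, π₁, _, m, hm⟩ := hex.exact_up_to_refinements (x ≫ biprod.inr) (by simpa using hx)
    dsimp at m hm
    have h1 : m ≫ ι = 0 := by simpa using (congrArg (· ≫ biprod.fst) hm).symm
    have h2 : π₁ ≫ x = m ≫ t := by simpa using congrArg (· ≫ biprod.snd) hm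
    rw [zero_of_comp_mono ι h1, zero_comp] at h2
    exact zero_of_epi_comp π₁ h2
  · exact epi_of_epi_fac (cokernel.π_desc (biprod.lift ι t) (biprod.fst ≫ cokernel.π ι) (by simp))

lemma prop_cokernel_lift {M I J : C} (ι : M ⟶ I) [Mono ι] (t : M ⟶ J)
    (hι : X (cokernel ι)) (hJ : X J) : X (cokernel (biprod.lift ι t)) :=
  X.prop_X₂_of_shortExact (shortExact_cokernel_lift ι t) hJ hι

end Closure

/-! ### The contractible complex `diskSum I`. -/

section Cone

variable {C : Type w} [Category.{v} C] [Preadditive C] [HasBinaryBiproducts C]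

/-- The contractible complex with terms `I k ⊞ I (k - 1)`, the direct sum over `k` of the
complexes `I k = I k` concentrated in degrees `k + 1` and `k`. -/
noncomputable def diskSum (I : ℤ → C) : ChainComplex C ℤ where
  X k := I k ⊞ I (k - 1)
  d i j := if h : j + 1 = i then
    biprod.snd ≫ eqToHom (by rw [← h, add_sub_cancel_right]) ≫ biprod.inl else 0
  shape i j h := dif_neg h
  d_comp_d' i j k hij hjk := by
    rw [dif_pos (show j + 1 = i from hij), dif_pos (show k + 1 = j from hjk)]
    simp

namespace diskSum

variable {I : ℤ → C} {A : C} {k : ℤ}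

/-- The projection of `diskSum I` to `I k` in degree `k`. -/
noncomputable def fst (I : ℤ → C) (k : ℤ) : (diskSum I).X k ⟶ I k :=
  (biprod.fst : I k ⊞ I (k - 1) ⟶ I k)

/-- The projection of `diskSum I` to `I (k - 1)` in degree `k`. -/
noncomputable def snd (I : ℤ → C) (k : ℤ) : (diskSum I).X k ⟶ I (k - 1) :=
  (biprod.snd : I k ⊞ I (k - 1) ⟶ I (k - 1))

/-- The morphism to the degree `k` part of `diskSum I` with given components. -/
noncomputable def lift (a : A ⟶ I k) (b : A ⟶ I (k - 1)) : A ⟶ (diskSum I).X k :=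
  biprod.lift a b

@[simp]
lemma lift_fst (a : A ⟶ I k) (b : A ⟶ I (k - 1)) : lift a b ≫ fst I k = a :=
  biprod.lift_fst a b

@[simp]
lemma lift_snd (a : A ⟶ I k) (b : A ⟶ I (k - 1)) : lift a b ≫ snd I k = b :=
  biprod.lift_snd a b

lemma hom_ext {g h : A ⟶ (diskSum I).X k} (h₁ : g ≫ fst I k = h ≫ fst I k)
    (h₂ : g ≫ snd I k = h ≫ snd I k) : g = h :=
  biprod.hom_ext _ _ h₁ h₂

lemma d_eq (i j : ℤ) (h : j + 1 = i) : (diskSum I).d i j =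
    snd I i ≫ eqToHom (by rw [← h, add_sub_cancel_right]) ≫ lift (𝟙 (I j)) 0 := by
  have : (lift (𝟙 (I j)) 0 : I j ⟶ (diskSum I).X j) =
      (biprod.inl : I j ⟶ I j ⊞ I (j - 1)) :=
    biprod.hom_ext _ _ (by simp [lift]) (by simp [lift])
  rw [this]
  exact dif_pos h

@[simp]
lemma d_fst (k : ℤ) : (diskSum I).d k (k - 1) ≫ fst I (k - 1) = snd I k := by
  simp [d_eq k (k - 1) (by simp)]

@[simp]
lemma d_snd (k : ℤ) : (diskSum I).d k (k - 1) ≫ snd I (k - 1) = 0 := by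
  simp [d_eq k (k - 1) (by simp)]

/-- The chain map to `diskSum I` determined by a family of morphisms to the `I k`. -/
noncomputable def homMk {K : ChainComplex C ℤ} (b : ∀ k, K.X k ⟶ I k) : K ⟶ diskSum I where
  f k := lift (b k) (K.d k (k - 1) ≫ b (k - 1))
  comm' i j h := by
    obtain rfl : j = i - 1 := eq_sub_of_add_eq h
    apply hom_ext <;> simp

@[simp]
lemma homMk_f_fst {K : ChainComplex C ℤ} (b : ∀ k, K.X k ⟶ I k) (k : ℤ) :
    (homMk b).f k ≫ fst I k = b k :=
  lift_fst _ _

/-- Commutation with `d` forces the second component in degree `k` from the first in degree `k - 1`.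
-/
lemma chainMap_ext {K : ChainComplex C ℤ} {g h : K ⟶ diskSum I}
    (H : ∀ k, g.f k ≫ fst I k = h.f k ≫ fst I k) : g = h := by
  have key (g : K ⟶ diskSum I) (k : ℤ) :
      g.f k ≫ snd I k = K.d k (k - 1) ≫ g.f (k - 1) ≫ fst I (k - 1) := by
    rw [← Category.assoc, ← g.comm, Category.assoc, d_fst]
  ext k
  refine hom_ext (H k) ?_
  rw [key, key, H]

/-- A cycle has zero second component; its first component, placed as second component one degree
higher, is a preimage under `d`. -/
lemma acyclic {C : Type w} [Category.{v} C] [Abelian C] (I : ℤ → C) :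
    (diskSum I).Acyclic := by
  intro k
  rw [HomologicalComplex.exactAt_iff_exact_up_to_refinements _ (k + 1) k (k - 1)
    (by simp) (by simp)]
  intro A x hx
  have hx' : x ≫ snd I k = 0 := by
    rw [← d_fst, ← Category.assoc, hx, zero_comp]
  refine ⟨A, 𝟙 A, inferInstance,
    lift 0 (x ≫ fst I k ≫ eqToHom (by rw [add_sub_cancel_right])), ?_⟩
  rw [d_eq (k + 1) k rfl]
  apply hom_ext
  · rw [Category.id_comp, ← Category.assoc (lift _ _), lift_snd]
    simp only [Category.assoc, lift_fst, Category.comp_id, eqToHom_trans, eqToHom_refl]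
  · simp [hx']

end diskSum

end Cone

/-! ### Extending chain maps into `X`-f.g. injective complexes. -/

variable {X : ObjectProperty (ModuleCat.{v} R)}

lemma xfgInjective_diskSum {I : ℤ → ModuleCat.{v} R} (hI : ∀ k, XInjective X (I k)) :
    XFGInjective X (diskSum I) := by
  intro S hS _ hX g
  have hex (k : ℤ) : ∃ b : S.X₂.X k ⟶ I k,
      S.f.f k ≫ b = g.f k ≫ diskSum.fst I k :=
    hI k (S.map (HomologicalComplex.eval _ _ k))
      ((HomologicalComplex.shortExact_iff_degreewise_shortExact S).1 hS k) (hX k) _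
  choose b hb using hex
  refine ⟨diskSum.homMk b, diskSum.chainMap_ext fun k => ?_⟩
  simp [hb]

variable [X.IsClosedUnderExtensions] [X.ContainsZero]

/-- An `X`-f.g. injective complex has the extension property against `[M ⟶ N] ⟶ [N = N]`
whenever `j : M ⟶ N` is monic with cokernel in `X`. -/
lemma XFGInjective.exists_extension {E : ChainComplex (ModuleCat.{v} R) ℤ}
    (hE : XFGInjective X E) (hfg : ∀ M : ModuleCat.{v} R, X M → Module.Finite R M)
    {M N : ModuleCat.{v} R} (j : M ⟶ N) [Mono j] (hj : X (cokernel j)) (k : ℤ)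
    (a : M ⟶ E.X k) (b : N ⟶ E.X (k - 1)) (hab : a ≫ E.d k (k - 1) = j ≫ b)
    (hb : b ≫ E.d (k - 1) (k - 1 - 1) = 0) :
    ∃ c : N ⟶ E.X k, j ≫ c = a ∧ c ≫ E.d k (k - 1) = b := by
  have hrel : (ComplexShape.down ℤ).Rel k (k - 1) := by simp
  have hne : k ≠ k - 1 := by omega
  let B := HomologicalComplex.double (𝟙 N) hrel
  let ι : HomologicalComplex.double j hrel ⟶ B :=
    HomologicalComplex.mkHomFromDouble hrel hne
      (j ≫ (HomologicalComplex.doubleXIso₀ (𝟙 N) hrel).inv)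
      (HomologicalComplex.doubleXIso₁ (𝟙 N) hrel hne).inv
      (by simp [B, HomologicalComplex.double_d _ _ hne])
      (fun l _ => by rw [HomologicalComplex.double_d_eq_zero₀ _ _ _ _ hne.symm, comp_zero])
  have hι₀ : ι.f k = (HomologicalComplex.doubleXIso₀ j hrel).hom ≫ j ≫
      (HomologicalComplex.doubleXIso₀ (𝟙 N) hrel).inv :=
    HomologicalComplex.mkHomFromDouble_f₀ ..
  have hι₁ : ι.f (k - 1) = (HomologicalComplex.doubleXIso₁ j hrel hne).hom ≫
      (HomologicalComplex.doubleXIso₁ (𝟙 N) hrel hne).inv :=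
    HomologicalComplex.mkHomFromDouble_f₁ ..
  have hiso (i : ℤ) (hi : i ≠ k) : IsIso (ι.f i) := by
    by_cases hi' : i = k - 1
    · subst hi'
      rw [hι₁]
      infer_instance
    · exact isIso_of_source_target_iso_zero _
        (HomologicalComplex.isZero_double_X _ hrel i hi hi').isoZero
        (HomologicalComplex.isZero_double_X _ hrel i hi hi').isoZero
  have hmono (i : ℤ) : Mono (ι.f i) := by
    by_cases hi : i = k
    · subst hi
      rw [hι₀]
      infer_instance
    · have := hiso i hi
      infer_instance
  have : Mono ι := HomologicalComplex.mono_of_mono_f ι hmono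
  have e (i : ℤ) : (cokernel ι).X i ≅ cokernel (ι.f i) :=
    PreservesCokernel.iso (HomologicalComplex.eval _ _ i) ι
  have hzero (i : ℤ) (hi : i ≠ k) : IsZero ((cokernel ι).X i) := by
    have := hiso i hi
    exact (isZero_cokernel_of_epi (ι.f i)).of_iso (e i)
  have hX : XStar X (cokernel ι) := by
    intro i
    by_cases hi : i = k
    · subst hi
      refine X.prop_of_iso (?_ ≪≫ (e i).symm) hj
      exact cokernel.mapIso _ _ (HomologicalComplex.doubleXIso₀ j hrel).symm
        (HomologicalComplex.doubleXIso₀ (𝟙 N) hrel).symm (by simp [hι₀])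
    · exact X.prop_of_isZero (hzero i hi)
  -- The cokernel of `ι` is `cokernel j` concentrated in degree `k`.
  obtain ⟨h, hh⟩ := hE (ShortComplex.mk ι (cokernel.π ι) (cokernel.condition ι))
    { exact := ShortComplex.exact_cokernel ι }
    ⟨⟨k, fun i hi => hzero i hi.ne'⟩, ⟨k, fun i hi => hzero i hi.ne⟩, fun i => hfg _ (hX i)⟩ hX
    (HomologicalComplex.mkHomFromDouble hrel hne a b hab (fun l hl => by
      obtain rfl : l = k - 1 - 1 := eq_sub_of_add_eq hl
      exact hb))
  have h₀ := congrArg (fun f => f.f k) hh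
  have h₁ := congrArg (fun f => f.f (k - 1)) hh
  have hc := h.comm k (k - 1)
  simp only [HomologicalComplex.comp_f, HomologicalComplex.mkHomFromDouble_f₀,
    HomologicalComplex.mkHomFromDouble_f₁, hι₀, hι₁, Category.assoc, Iso.cancel_iso_hom_left]
    at h₀ h₁
  refine ⟨(HomologicalComplex.doubleXIso₀ (𝟙 N) hrel).inv ≫ h.f k, h₀, ?_⟩
  rw [Category.assoc, hc, ← h₁]
  simp [B, HomologicalComplex.double_d _ _ hne]

/-- `g` is a partial extension of `f` along `φ`, defined in degrees below `n`. -/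
def IsPartialExtension {Y E E' : ChainComplex (ModuleCat.{v} R) ℤ} (φ : Y ⟶ E) (f : Y ⟶ E')
    (n : ℤ) (g : ∀ i, E.X i ⟶ E'.X i) : Prop :=
  ∀ i < n, φ.f i ≫ g i = f.f i ∧ g i ≫ E'.d i (i - 1) = E.d i (i - 1) ≫ g (i - 1)

lemma IsPartialExtension.exists_succ {Y E E' : ChainComplex (ModuleCat.{v} R) ℤ} {φ : Y ⟶ E}
    {f : Y ⟶ E'} [Mono φ] (hφ : ∀ i, X (cokernel (φ.f i))) (hE' : XFGInjective X E')
    (hfg : ∀ M : ModuleCat.{v} R, X M → Module.Finite R M)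
    {n : ℤ} {g : ∀ i, E.X i ⟶ E'.X i} (hg : IsPartialExtension φ f n g) :
    ∃ g' : ∀ i, E.X i ⟶ E'.X i, IsPartialExtension φ f (n + 1) g' ∧ ∀ i < n, g' i = g i := by
  have hn := hg (n - 1) (by omega)
  have : Mono (φ.f n) := inferInstance
  -- The differential of the new component is prescribed by `g (n - 1)`; the prescribed value is a
  -- cycle because `g` commutes with `d` in degree `n - 1`.
  obtain ⟨c, hc₁, hc₂⟩ := hE'.exists_extension hfg (φ.f n) (hφ n) n (f.f n)
    (E.d n (n - 1) ≫ g (n - 1))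
    (by rw [f.comm, ← hn.1, ← Category.assoc, ← φ.comm, Category.assoc])
    (by rw [Category.assoc, hn.2, ← Category.assoc, E.d_comp_d, zero_comp])
  have hlt (i : ℤ) (hi : i < n) : Function.update g n c i = g i :=
    Function.update_of_ne hi.ne _ _
  refine ⟨Function.update g n c, fun i hi => ?_, hlt⟩
  rw [hlt (i - 1) (by omega)]
  obtain hi | rfl := (Int.lt_add_one_iff.1 hi).lt_or_eq
  · rw [hlt i hi]
    exact hg i hi
  · rw [Function.update_self]
    exact ⟨hc₁, hc₂⟩

/-- Morphisms to an `X`-f.g. injective complex extend along degreewise monomorphisms of right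
bounded complexes with cokernel in `C(X*)`. -/
lemma XFGInjective.exists_extension_of_rightBounded {Y E E' : ChainComplex (ModuleCat.{v} R) ℤ}
    (hE' : XFGInjective X E') (hfg : ∀ M : ModuleCat.{v} R, X M → Module.Finite R M)
    (φ : Y ⟶ E) [Mono φ] (hφ : ∀ i, X (cokernel (φ.f i))) (hY : RightBounded Y)
    (hE : RightBounded E) (f : Y ⟶ E') : ∃ g : E ⟶ E', φ ≫ g = f := by
  obtain ⟨n, hn⟩ : ∃ n : ℤ, ∀ i < n, IsZero (Y.X i) ∧ IsZero (E.X i) := by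
    obtain ⟨n₁, hn₁⟩ := hY
    obtain ⟨n₂, hn₂⟩ := hE
    exact ⟨min n₁ n₂, fun i hi => ⟨hn₁ i (by omega), hn₂ i (by omega)⟩⟩
  let G (m : ℕ) := { g : ∀ i, E.X i ⟶ E'.X i // IsPartialExtension φ f (n + m) g }
  have step (m : ℕ) (g : G m) : ∃ g' : G (m + 1), ∀ i < n + m, g'.1 i = g.1 i := by
    obtain ⟨g', h, h'⟩ := g.2.exists_succ hφ hE' hfg
    exact ⟨⟨g', by rwa [Nat.cast_add_one, ← add_assoc]⟩, h'⟩
  choose next hnext using step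
  have g₀ : G 0 := ⟨fun _ => 0, fun i hi =>
    ⟨(hn i (by omega)).1.eq_of_src _ _, (hn i (by omega)).2.eq_of_src _ _⟩⟩
  let s (m : ℕ) : G m := Nat.rec g₀ next m
  have hs (m : ℕ) (i : ℤ) (hi : i < n + m) (p : ℕ) : (s (m + p)).1 i = (s m).1 i := by
    induction p with
    | zero => rfl
    | succ p ih => exact (hnext (m + p) (s (m + p)) i (by push_cast; omega)).trans ih
  have hs' (m p : ℕ) (i : ℤ) (hm : i < n + m) (hp : i < n + p) : (s m).1 i = (s p).1 i := by
    have hcongr (a b : ℕ) (h : a = b) : (s a).1 i = (s b).1 i := by rw [h]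
    rw [← hs m i hm p, ← hs p i hp m, hcongr _ _ (add_comm m p)]
  -- A stage at which degree `i` is already settled; the stages agree wherever they are settled, so
  -- they glue.
  let t (i : ℤ) : ℕ := (i - n + 1).toNat
  have ht (i : ℤ) : i < n + t i := by
    have := Int.self_le_toNat (i - n + 1)
    dsimp only [t]
    omega
  refine ⟨{ f := fun i => (s (t i)).1 i, comm' := fun i j hij => ?_ }, ?_⟩
  · obtain rfl : j = i - 1 := eq_sub_of_add_eq hij
    rw [((s (t i)).2 i (ht i)).2, hs' (t (i - 1)) (t i) (i - 1) (ht _) (by have := ht i; omega)]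
  · ext1 i
    exact ((s (t i)).2 i (ht i)).1

lemma exists_preenvelope (hfg : ∀ M : ModuleCat.{v} R, X M → Module.Finite R M)
    (hpre : ∀ M : ModuleCat.{v} R, X M → ∃ (E : ModuleCat.{v} R) (φ : M ⟶ E),
      Mono φ ∧ IsPreenvelope (XInjective X) φ ∧ X (cokernel φ))
    {Y : ChainComplex (ModuleCat.{v} R) ℤ} (hY : RightBounded Y) (hYX : XStar X Y) :
    ∃ (E : ChainComplex (ModuleCat.{v} R) ℤ) (φ : Y ⟶ E),
      Mono φ ∧ E.Acyclic ∧ IsPreenvelope (XFGInjective X) φ := by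
  have hpre' (M : ModuleCat.{v} R) (hM : X M) : ∃ (E : ModuleCat.{v} R) (φ : M ⟶ E),
      Mono φ ∧ XInjective X E ∧ X (cokernel φ) ∧ (IsZero M → IsZero E) := by
    -- A preenvelope of a zero module may be nonzero; taking the identity there keeps `diskSum I`
    -- right bounded.
    by_cases h : IsZero M
    · refine ⟨M, 𝟙 M, inferInstance, fun S _ _ g => ⟨0, h.eq_of_tgt _ _⟩,
        X.prop_of_isZero (isZero_cokernel_of_epi _), id⟩
    · obtain ⟨E, φ, h₁, h₂, h₃⟩ := hpre M hM
      exact ⟨E, φ, h₁, h₂.mem, h₃, fun h' => (h h').elim⟩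
  choose I ι hmono hI hcoker hzero using fun k => hpre' (Y.X k) (hYX k)
  have hIX (k : ℤ) : X (I k) :=
    X.prop_X₂_of_shortExact
      (S := ShortComplex.mk (ι k) (cokernel.π (ι k)) (cokernel.condition _))
      { exact := ShortComplex.exact_cokernel _ } (hYX k) (hcoker k)
  have hm : Mono (diskSum.homMk ι) := HomologicalComplex.mono_of_mono_f _ fun k =>
    mono_of_mono_fac (biprod.lift_fst (ι k) (Y.d k (k - 1) ≫ ι (k - 1)))
  have hE : RightBounded (diskSum I) := by
    obtain ⟨n, hn⟩ := hY
    refine ⟨n, fun i hi => (biprod_isZero_iff _ _).2 ⟨hzero _ (hn i hi), hzero _ (hn _ ?_)⟩⟩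
    omega
  exact ⟨diskSum I, diskSum.homMk ι, hm, diskSum.acyclic I, xfgInjective_diskSum hI,
    fun E' hE' f => hE'.exists_extension_of_rightBounded hfg (diskSum.homMk ι)
      (fun k => prop_cokernel_lift X (ι k) _ (hcoker k) (hIX _)) hY hE f⟩

/-- Closure under extensions alone allows `X` to be empty; the vanishing terms of `Y` supply a zero
object. -/
lemma containsZero_of_rightBounded {X : ObjectProperty (ModuleCat.{v} R)}
    {Y : ChainComplex (ModuleCat.{v} R) ℤ} (hY : RightBounded Y)
    (hYX : XStar X Y) : X.ContainsZero := by
  obtain ⟨n, hn⟩ := hY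
  exact ⟨Y.X (n - 1), hn _ (by omega), hYX _⟩

end XInj

lemma HomologicalComplex.Acyclic.of_retract {C : Type w} [Category.{v} C] [Abelian C] {ι : Type*}
    {c : ComplexShape ι} {K L : HomologicalComplex C c} (hL : L.Acyclic) (r : Retract K L) :
    K.Acyclic := by
  intro i
  rw [HomologicalComplex.exactAt_iff_isZero_homology, Limits.IsZero.iff_id_eq_zero]
  have h := (hL i).isZero_homology
  rw [← HomologicalComplex.homologyMap_id, ← r.retract, HomologicalComplex.homologyMap_comp,
    h.eq_of_tgt (HomologicalComplex.homologyMap r.i i) 0, Limits.zero_comp]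

theorem theorem3p9 {R : Type u} [Ring R] (X : ObjectProperty (ModuleCat.{v} R))
    (hfp : ∀ M : ModuleCat.{v} R, X M → Module.FinitePresentation R M)
    (hext : X.IsClosedUnderExtensions)
    (hpre : ∀ M : ModuleCat.{v} R, X M → ∃ (E : ModuleCat.{v} R) (φ : M ⟶ E),
      Mono φ ∧ XInj.IsPreenvelope (XInj.XInjective X) φ ∧ X (Limits.cokernel φ)) :
    (∀ Y : ChainComplex (ModuleCat.{v} R) ℤ, XInj.RightBounded Y → XInj.XStar X Y →
      ∃ (E : ChainComplex (ModuleCat.{v} R) ℤ) (φ : Y ⟶ E),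
        Mono φ ∧ E.Acyclic ∧ XInj.IsPreenvelope (XInj.XFGInjective X) φ) ∧
    (∀ Y : ChainComplex (ModuleCat.{v} R) ℤ, XInj.RightBounded Y → XInj.XStar X Y →
      XInj.XFGInjective X Y → Y.Acyclic) := by
  have hfg (M : ModuleCat.{v} R) (hM : X M) : Module.Finite R M := by
    have := hfp M hM
    infer_instance
  refine ⟨fun Y hY hYX => ?_, fun Y hY hYX hYinj => ?_⟩ <;>
    have := XInj.containsZero_of_rightBounded hY hYX
  · exact XInj.exists_preenvelope hfg hpre hY hYX
  · obtain ⟨E, φ, -, hE, hφ⟩ := XInj.exists_preenvelope hfg hpre hY hYX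
    obtain ⟨r, hr⟩ := hφ.factors hYinj (𝟙 Y)
    exact hE.of_retract ⟨φ, r, hr⟩
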